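/- \textbf{Theorem (Coderivatives of the discretized reachable map).} \emph{Notation.} For $C\subset\mathbb{R}^m$ and $\bar x\in C$, the regular normal cone is $\hat N_C(\bar x)=\{y : \langle y,x-\bar x\rangle\le o(\|x-\bar x\|)\text{ for }x\in C\}$, and the limiting normal cone $N_C(\bar x)$ is the set of all limits of sequences $y_i\in\hat N_C(x_i)$ with $x_i\in C$, $x_i\to\bar x$. For a set-valued map $S:\mathbb{R}^n\rightrightarrows\mathbb{R}^m$ and $\bar y\in S(\bar x)$, the limiting coderivative $D^*S(\bar x\mid\bar y):\mathbb{R}^m\rightrightarrows\mathbb{R}^n$ is given by $v\in D^*S(\bar x\mid\bar y)(u)\iff (v,-u)\in N_{\mathrm{Graph}(S)}(\bar x,\bar y)$. Set-valued maps are composed by $(S_2\circ S_1)(x)=\bigcup_{y\in S_1(x)}S_2(y)$. $S$ is graph convex if $\mathrm{Graph}(S)$ is convex. $S$ is locally Lipschitz if it is closed-valued and every point has a neighbourhood $U$ and a $\kappa\ge0$ with $S(x')\subset S(x'')+\kappa\|x'-x''\|\mathbb{B}$ for all $x',x''\in U$, and locally bounded if every point has a neighbourhood $U$ and a finite $R$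 with $S(x')\subset R\,\mathbb{B}$ for all $x'\in U$; here $\mathbb{B}$ is the closed unit ball. \emph{Setting.} Let $T>0$, $N\ge1$, $\Delta t=T/N$, and $F:[0,T]\times\mathbb{R}^n\rightrightarrows\mathbb{R}^n$. For $0\le k\le N-1$ put $F_{k,N}(x)=F(k\Delta t,x)$ and $M_{k,N}(x)=x+\Delta t\,F_{k,N}(x)$. For $x_0,x_N\in\mathbb{R}^n$ let $\mathcal{X}_N(x_0,x_N)$ be the set of all $\{\tilde x_i\}_{i=0}^N$ with $\tilde x_0=x_0$, $\tilde x_N=x_N$ and $\tilde x_k\in M_{k-1,N}(\tilde x_{k-1})$ for $1\le k\le N$, and let $R_N(x_0)=\{x_N:\mathcal{X}_N(x_0,x_N)\ne\emptyset\}$. Suppose that every $F_{k,N}$ ($0\le k\le N-1$) is locally Lipschitz and locally bounded. \emph{Conclusion.} $R_N=M_{N-1,N}\circ\cdots\circ M_{0,N}$, and for all $x_0$ and all $x_N\in R_N(x_0)$: (1) For every $p\in\mathbb{R}^n$, $$D^*R_N(x_0\mid x_N)(p)\subset\bigcup_{\{\tilde x_i\}\in\mathcal{X}_N(x_0,x_N)}\big(D^*M_{0,N}(\tilde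 x_0\mid\tilde x_1)\circ\cdots\circ D^*M_{N-1,N}(\tilde x_{N-1}\mid\tilde x_N)\big)(p).$$ (2) If all $F_{k,N}$ are graph convex, then for every $\{\tilde x_i\}\in\mathcal{X}_N(x_0,x_N)$, $$D^*R_N(x_0\mid x_N)=D^*M_{0,N}(\tilde x_0\mid\tilde x_1)\circ\cdots\circ D^*M_{N-1,N}(\tilde x_{N-1}\mid\tilde x_N).$$ (3) For $p_0,p_N\in\mathbb{R}^n$ consider the conditions (a) $p_0\in D^*R_N(x_0\mid x_N)(p_N)$; (b) there are $\{\tilde x_i\}_{i=0}^N\in\mathcal{X}_N(x_0,x_N)$ and $\{\tilde p_i\}_{i=0}^N\subset\mathbb{R}^n$ with $\tilde p_0=p_0$, $\tilde p_N=p_N$ and $$\frac{\tilde p_k-\tilde p_{k-1}}{\Delta t}\in-D^*F_{k-1,N}\Big(\tilde x_{k-1}\,\Big|\,\frac{\tilde x_k-\tilde x_{k-1}}{\Delta t}\Big)(\tilde p_k)\qquad\text{for all }1\le k\le N.$$ Then (a) implies (b); if all $F_{k,N}$ are graph convex, (b) implies (a). -/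

import Mathlib

open Filter Topology
open scoped Pointwise

/-- The Euclidean space `ℝⁿ`. -/
abbrev Eucl (n : ℕ) : Type := EuclideanSpace ℝ (Fin n)

/-- A set-valued map `X ⇉ Y`. -/
abbrev SetMap (X Y : Type*) : Type _ := X → Set Y

/-- Regular normal cone: `y` with `⟪y, x - x̄⟫ ≤ o(‖x - x̄‖)` for `x ∈ C`; empty when `x̄ ∉ C`. -/
def regularNormalCone {H : Type*} [NormedAddCommGroup H] [InnerProductSpace ℝ H]
    (C : Set H) (xbar : H) : Set H :=
  {y | xbar ∈ C ∧ ∀ ε : ℝ, 0 < ε → ∀ᶠ x in 𝓝[C] xbar, inner ℝ y (x - xbar) ≤ ε * ‖x - xbar‖}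

/-- Limiting (Mordukhovich) normal cone: limits of regular normals at points of `C` tending
to `x̄`; empty when `x̄ ∉ C`. -/
def limitingNormalCone {H : Type*} [NormedAddCommGroup H] [InnerProductSpace ℝ H]
    (C : Set H) (xbar : H) : Set H :=
  {y | xbar ∈ C ∧ ∃ (x : ℕ → H) (v : ℕ → H), (∀ i, x i ∈ C) ∧ Tendsto x atTop (𝓝 xbar) ∧
    (∀ i, v i ∈ regularNormalCone C (x i)) ∧ Tendsto v atTop (𝓝 y)}

/-- The graph of a set-valued map, inside the Hilbert product `X × Y`. -/
def svGraph {X Y : Type*} (S : SetMap X Y) : Set (WithLp 2 (X × Y)) :=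
  {z | z.snd ∈ S z.fst}

/-- Limiting coderivative: `v ∈ D*S(x̄ | ȳ)(u)` iff `(v, -u)` is a limiting normal to the graph
of `S` at `(x̄, ȳ)`. -/
def coderivative {X Y : Type*} [NormedAddCommGroup X] [InnerProductSpace ℝ X]
    [NormedAddCommGroup Y] [InnerProductSpace ℝ Y] (S : SetMap X Y) (xbar : X) (ybar : Y) :
    SetMap Y X :=
  fun u => {v | WithLp.toLp 2 (v, -u) ∈ limitingNormalCone (svGraph S) (WithLp.toLp 2 (xbar, ybar))}

/-- The set-valued map `S` has a convex graph. -/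
def GraphConvex {X Y : Type*} [NormedAddCommGroup X] [InnerProductSpace ℝ X]
    [NormedAddCommGroup Y] [InnerProductSpace ℝ Y] (S : SetMap X Y) : Prop :=
  Convex ℝ (svGraph S)

/-- Composition `S₂ ∘ S₁` of set-valued maps. -/
def svComp {X Y Z : Type*} (S₂ : SetMap Y Z) (S₁ : SetMap X Y) : SetMap X Z :=
  fun x => ⋃ y ∈ S₁ x, S₂ y

/-- The composition `D 0 ∘ D 1 ∘ ⋯ ∘ D (N - 1)` (the identity if `N = 0`). -/
def svCompChain {X : Type*} : (N : ℕ) → (Fin N → SetMap X X) → SetMap X X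
  | 0, _ => fun x => {x}
  | N + 1, D => svComp (D 0) (svCompChain N fun k => D k.succ)

/-- Local Lipschitz continuity of a set-valued map: closed values and, near every point,
`S(x') ⊆ S(x'') + κ ‖x' - x''‖ 𝔹`, where `𝔹` is the closed unit ball. (As usual in variational
analysis, closedness of the values is part of the notion; non-emptiness is not required.) -/
def SVLocallyLipschitz {X Y : Type*} [NormedAddCommGroup X] [NormedAddCommGroup Y]
    (S : SetMap X Y) : Prop :=
  (∀ x, IsClosed (S x)) ∧
    ∀ x, ∃ U ∈ 𝓝 x, ∃ κ : ℝ, 0 ≤ κ ∧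
      ∀ x' ∈ U, ∀ x'' ∈ U, S x' ⊆ S x'' + Metric.closedBall (0 : Y) (κ * ‖x' - x''‖)

/-- Local boundedness of a set-valued map at every point. -/
def SVLocallyBounded {X Y : Type*} [NormedAddCommGroup X] [NormedAddCommGroup Y]
    (S : SetMap X Y) : Prop :=
  ∀ x, ∃ U ∈ 𝓝 x, ∃ R : ℝ, ∀ x' ∈ U, S x' ⊆ Metric.closedBall (0 : Y) R

/-- `F_{k,N} = F(k Δt, ·)` with `Δt = T / N`. -/
noncomputable def discF {n : ℕ} (F : ℝ → SetMap (Eucl n) (Eucl n)) (T : ℝ) (N k : ℕ) :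
    SetMap (Eucl n) (Eucl n) :=
  F ((k : ℝ) * (T / (N : ℝ)))

/-- `M_{k,N}(x) = x + Δt F_{k,N}(x)`. -/
noncomputable def discM {n : ℕ} (F : ℝ → SetMap (Eucl n) (Eucl n)) (T : ℝ) (N k : ℕ) :
    SetMap (Eucl n) (Eucl n) :=
  fun x => (fun w => x + (T / (N : ℝ)) • w) '' discF F T N k x

/-- The feasible discrete paths `x̃_0, …, x̃_N` with `x̃_0 = x₀` and `x̃_N = x_N`. -/
def feasiblePaths {n : ℕ} (F : ℝ → SetMap (Eucl n) (Eucl n)) (T : ℝ) (N : ℕ)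
    (x0 xN : Eucl n) : Set (Fin (N + 1) → Eucl n) :=
  {x | (∀ k : Fin N, x k.succ ∈ discM F T N k (x k.castSucc)) ∧ x 0 = x0 ∧ x (Fin.last N) = xN}

/-- The discretized reachable map `R_N`: end points of feasible discrete paths. -/
def discReach {n : ℕ} (F : ℝ → SetMap (Eucl n) (Eucl n)) (T : ℝ) (N : ℕ) :
    SetMap (Eucl n) (Eucl n) :=
  fun x0 => {xN | ∃ x : Fin (N + 1) → Eucl n, x ∈ feasiblePaths F T N x0 xN}

/-- `D*M_{0,N}(x̃_0 | x̃_1) ∘ ⋯ ∘ D*M_{N-1,N}(x̃_{N-1} | x̃_N)` along a path `x̃`. -/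
noncomputable def pathCoderivative {n : ℕ} (F : ℝ → SetMap (Eucl n) (Eucl n)) (T : ℝ) (N : ℕ)
    (x : Fin (N + 1) → Eucl n) : SetMap (Eucl n) (Eucl n) :=
  svCompChain N fun k : Fin N => coderivative (discM F T N k) (x k.castSucc) (x k.succ)

/-- There are a feasible path `x̃` from `x₀` to `x_N` and `p̃_0, …, p̃_N` with `p̃_0 = p₀`,
`p̃_N = p_N` satisfying the discrete Euler–Lagrange inclusion
`(p̃_{k+1} - p̃_k) / Δt ∈ -D*F_{k,N}(x̃_k | (x̃_{k+1} - x̃_k) / Δt)(p̃_{k+1})` for `0 ≤ k < N`. -/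
def HasDiscreteAdjoint {n : ℕ} (F : ℝ → SetMap (Eucl n) (Eucl n)) (T : ℝ) (N : ℕ)
    (x0 xN p0 pN : Eucl n) : Prop :=
  ∃ x ∈ feasiblePaths F T N x0 xN, ∃ p : Fin (N + 1) → Eucl n,
    p 0 = p0 ∧ p (Fin.last N) = pN ∧
      ∀ k : Fin N, (1 / (T / (N : ℝ))) • (p k.succ - p k.castSucc) ∈
        -(coderivative (discF F T N k) (x k.castSucc)
            ((1 / (T / (N : ℝ))) • (x k.succ - x k.castSucc)) (p k.succ))

/-! ### Normal cones: proximal approximation, convex sets, linear changes of variables. -/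

section NormalCones

variable {H : Type*} [NormedAddCommGroup H] [InnerProductSpace ℝ H]

/-! The reachable map is a composition of the Euler maps x ↦ x + Δt F(x), so everything reduces to a
chain rule for the coderivative of `svComp S₂ S₁`, iterated by peeling off the last step.

For the chain rule (`coderivative_svComp`), a limiting normal to the graph of the composition is
approximated by proximal normals, which satisfy a quadratic inequality on the whole graph. Such an
inequality is a minimization over triples (a, b, c) with b ∈ S₁(a), c ∈ S₂(b). Doubling the
intermediate variable b and penalizing the squared gap decouples the two graphs; freezing one pair
at a minimizer gives a regular normal to the other graph, with almost equal intermediate multipliers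
(`exists_fuzzy_chain`). The Lipschitz property of S₂ bounds these multipliers
(`norm_le_of_mem_regularNormalCone_svGraph`), and local boundedness of S₁ bounds the intermediate
points, so subsequences converge to the exact rule.

With convex graphs the normal inequality is global and free of error terms. The intermediate point
can then be prescribed, and conversely the stepwise inequalities add up along any path, which gives
equality for every path.

The Euler–Lagrange form follows because the graph of x + h S(x) is a shear of the graph of S, and
limiting normals transform by the adjoint (`mem_coderivative_eulerMap`). -/

theorem mem_regularNormalCone_of_quadratic {C : Set H} {x y : H} {σ : ℝ} (hx : x ∈ C)
    (h : ∀ᶠ c in 𝓝[C] x, inner ℝ y (c - x) ≤ σ * ‖c - x‖ ^ 2) :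
    y ∈ regularNormalCone C x := by
  refine ⟨hx, fun ε hε => ?_⟩
  have hlim : Tendsto (fun c : H => σ * ‖c - x‖) (𝓝[C] x) (𝓝 0) := by
    have : Continuous fun c : H => σ * ‖c - x‖ := by fun_prop
    simpa using (this.tendsto x).mono_left nhdsWithin_le_nhds
  filter_upwards [h, hlim.eventually (gt_mem_nhds hε)] with c hc hc'
  calc inner ℝ y (c - x) ≤ σ * ‖c - x‖ ^ 2 := hc
    _ = (σ * ‖c - x‖) * ‖c - x‖ := by ring
    _ ≤ ε * ‖c - x‖ := by gcongr

theorem mem_limitingNormalCone_of_regular {C : Set H} {x y : H} (h : y ∈ regularNormalCone C x) :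
    y ∈ limitingNormalCone C x :=
  ⟨h.1, fun _ => x, fun _ => y, fun _ => h.1, tendsto_const_nhds, fun _ => h, tendsto_const_nhds⟩

/-- Near a regular normal to a closed set there are proximal normals. -/
theorem exists_proximal_near_regular [FiniteDimensional ℝ H] {C : Set H} (hC : IsClosed C)
    {x y : H} (h : y ∈ regularNormalCone C x) {δ : ℝ} (hδ : 0 < δ) :
    ∃ x' ∈ C, ∃ (y' : H) (σ : ℝ), 0 ≤ σ ∧ ‖x' - x‖ < δ ∧ ‖y' - y‖ < δ ∧
      ∀ c ∈ C, inner ℝ y' (c - x') ≤ σ * ‖c - x'‖ ^ 2 := by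
  obtain ⟨hx, h⟩ := h
  obtain ⟨r, hr, hball⟩ := Metric.mem_nhdsWithin_iff.1 (h (δ / 3) (by positivity))
  -- The bound by `r` keeps the projection below inside the ball where the regular normal inequality
  -- holds, since its distance to `x` is at most 2t‖y‖.
  obtain ⟨t, ht, ht1, htr⟩ : ∃ t : ℝ, 0 < t ∧ t ≤ 1 ∧ 2 * t * ‖y‖ < r := by
    refine ⟨min 1 (r / (2 * (‖y‖ + 1))), by positivity, min_le_left _ _, ?_⟩
    have h1 : min 1 (r / (2 * (‖y‖ + 1))) ≤ r / (2 * (‖y‖ + 1)) := min_le_right _ _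
    rw [le_div_iff₀ (by positivity)] at h1
    have h2 : 0 < min 1 (r / (2 * (‖y‖ + 1))) := by positivity
    nlinarith
  -- The proximal normal comes from projecting x + t y onto `C`: comparison with `x` itself yields
  -- ‖d‖² ≤ 2t⟪y, d⟫, and regularity of `y` then forces ‖d‖ ≤ 2tδ/3, so that d/t is small too.
  obtain ⟨z, hzC, hz⟩ := hC.exists_infDist_eq_dist ⟨x, hx⟩ (x + t • y)
  have hmin : ∀ c ∈ C, ‖t • y - (z - x)‖ ≤ ‖t • y - (c - x)‖ := fun c hc => by
    have := Metric.infDist_le_dist_of_mem (x := x + t • y) hc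
    rw [hz, dist_eq_norm, dist_eq_norm] at this
    have e : ∀ a : H, x + t • y - a = t • y - (a - x) := fun a => by abel
    rwa [e, e] at this
  set d := z - x with hd
  have h0 : ‖t • y - d‖ ≤ ‖t • y‖ := by simpa using hmin x hx
  have hty : ‖t • y‖ = t * ‖y‖ := by rw [norm_smul, Real.norm_of_nonneg ht.le]
  have hdr : ‖d‖ < r := by
    have : ‖d‖ ≤ ‖t • y‖ + ‖t • y - d‖ := by
      simpa using norm_sub_le (t • y) (t • y - d)
    linarith
  have hin : inner ℝ y d ≤ δ / 3 * ‖d‖ :=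
    hball ⟨by simpa [dist_eq_norm] using hdr, hzC⟩
  have hsq : ‖d‖ ^ 2 ≤ 2 * t * inner ℝ y d := by
    have h1 := norm_sub_sq_real (t • y) d
    have h2 : ‖t • y - d‖ ^ 2 ≤ ‖t • y‖ ^ 2 := by gcongr
    rw [real_inner_smul_left] at h1
    linarith
  have hdn : ‖d‖ ≤ 2 * t * (δ / 3) := by
    by_contra! hcon
    have : 0 ≤ 2 * t * (δ / 3) := by positivity
    nlinarith
  refine ⟨z, hzC, y - t⁻¹ • d, (2 * t)⁻¹, by positivity, by nlinarith, ?_, fun c hc => ?_⟩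
  · rw [sub_sub_cancel_left, norm_neg, norm_smul, Real.norm_of_nonneg (by positivity),
      inv_mul_lt_iff₀ ht]
    nlinarith
  · have h1 := hmin c hc
    have h2 : t • y - (c - x) = (t • y - d) - (c - z) := by rw [hd]; abel
    rw [h2] at h1
    have h3 := norm_sub_sq_real (t • y - d) (c - z)
    have h4 : ‖t • y - d‖ ^ 2 ≤ ‖t • y - d - (c - z)‖ ^ 2 := by gcongr
    have h5 : t • y - d = t • (y - t⁻¹ • d) := by
      rw [smul_sub, smul_inv_smul₀ ht.ne']
    have h6 : 2 * t * inner ℝ (y - t⁻¹ • d) (c - z) ≤ ‖c - z‖ ^ 2 := by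
      have := real_inner_smul_left (y - t⁻¹ • d) (c - z) t
      rw [← h5] at this
      linarith
    rw [le_inv_mul_iff₀ (by positivity)]
    exact h6

theorem exists_proximal_near_limiting [FiniteDimensional ℝ H] {C : Set H} (hC : IsClosed C)
    {x y : H} (h : y ∈ limitingNormalCone C x) {δ : ℝ} (hδ : 0 < δ) :
    ∃ x' ∈ C, ∃ (y' : H) (σ : ℝ), 0 ≤ σ ∧ ‖x' - x‖ < δ ∧ ‖y' - y‖ < δ ∧
      ∀ c ∈ C, inner ℝ y' (c - x') ≤ σ * ‖c - x'‖ ^ 2 := by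
  obtain ⟨-, xs, ys, -, hxs, hys, hyl⟩ := h
  obtain ⟨i, hi1, hi2⟩ := ((Metric.tendsto_nhds.1 hxs (δ / 2) (by positivity)).and
    (Metric.tendsto_nhds.1 hyl (δ / 2) (by positivity))).exists
  obtain ⟨x', hx', y', σ, hσ, h1, h2, h3⟩ :=
    exists_proximal_near_regular hC (hys i) (half_pos hδ)
  rw [dist_eq_norm] at hi1 hi2
  refine ⟨x', hx', y', σ, hσ, ?_, ?_, h3⟩
  · linarith [norm_sub_le_norm_sub_add_norm_sub x' (xs i) x]
  · linarith [norm_sub_le_norm_sub_add_norm_sub y' (ys i) y]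

/-- Regular normals to a convex set are normals in the sense of convex analysis. -/
theorem inner_le_zero_of_mem_regularNormalCone {C : Set H} (hC : Convex ℝ C) {x y : H}
    (h : y ∈ regularNormalCone C x) {c : H} (hc : c ∈ C) : inner ℝ y (c - x) ≤ 0 := by
  obtain ⟨hx, h⟩ := h
  have key : ∀ ε : ℝ, 0 < ε → inner ℝ y (c - x) ≤ ε * ‖c - x‖ := fun ε hε => by
    -- By convexity the segment from `x` to `c` stays in `C`; the regular inequality along it can be
    -- divided by `t`.
    have hT : Tendsto (fun t : ℝ => x + t • (c - x)) (𝓝[>] 0) (𝓝[C] x) := by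
      refine tendsto_nhdsWithin_iff.2 ⟨?_, ?_⟩
      · have : Continuous fun t : ℝ => x + t • (c - x) := by fun_prop
        simpa using (this.tendsto 0).mono_left nhdsWithin_le_nhds
      · filter_upwards [Ioc_mem_nhdsGT (zero_lt_one' ℝ)] with t ht
        exact hC.add_smul_sub_mem hx hc ⟨ht.1.le, ht.2⟩
    obtain ⟨t, ht, ht0⟩ := ((hT.eventually (h ε hε)).and self_mem_nhdsWithin).exists
    have ht0 : 0 < t := ht0
    rw [add_sub_cancel_left, real_inner_smul_right, norm_smul, Real.norm_of_nonneg ht0.le] at ht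
    exact le_of_mul_le_mul_left (by linarith) ht0
  refine le_of_forall_pos_le_add fun η hη => ?_
  have := key (η / (‖c - x‖ + 1)) (by positivity)
  rw [zero_add]
  refine this.trans ?_
  rw [div_mul_eq_mul_div, div_le_iff₀ (by positivity)]
  nlinarith [norm_nonneg (c - x)]

theorem inner_le_zero_of_mem_limitingNormalCone {C : Set H} (hC : Convex ℝ C) {x y : H}
    (h : y ∈ limitingNormalCone C x) {c : H} (hc : c ∈ C) : inner ℝ y (c - x) ≤ 0 := by
  obtain ⟨-, xs, ys, -, hxs, hys, hyl⟩ := h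
  exact le_of_tendsto (hyl.inner (hxs.const_sub c))
    (Eventually.of_forall fun i => inner_le_zero_of_mem_regularNormalCone hC (hys i) hc)

theorem mem_limitingNormalCone_of_inner_le_zero {C : Set H} {x y : H} (hx : x ∈ C)
    (h : ∀ c ∈ C, inner ℝ y (c - x) ≤ 0) : y ∈ limitingNormalCone C x :=
  mem_limitingNormalCone_of_regular <| mem_regularNormalCone_of_quadratic (σ := 0) hx <|
    eventually_nhdsWithin_of_forall fun c hc => by simpa using h c hc

theorem smul_mem_limitingNormalCone {C : Set H} {x y : H} (h : y ∈ limitingNormalCone C x)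
    {t : ℝ} (ht : 0 < t) : t • y ∈ limitingNormalCone C x := by
  obtain ⟨hx, xs, ys, hxC, hxs, hys, hyl⟩ := h
  refine ⟨hx, xs, fun i => t • ys i, hxC, hxs, fun i => ⟨hxC i, fun ε hε => ?_⟩,
    hyl.const_smul t⟩
  filter_upwards [(hys i).2 (ε / t) (by positivity)] with c hc
  rw [real_inner_smul_left]
  calc t * inner ℝ (ys i) (c - xs i) ≤ t * (ε / t * ‖c - xs i‖) := by gcongr
    _ = ε * ‖c - xs i‖ := by field_simp

variable {H' : Type*} [NormedAddCommGroup H'] [InnerProductSpace ℝ H']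

theorem regularNormalCone_pullback {C : Set H} {C' : Set H'} (A : H →L[ℝ] H') (B : H' →L[ℝ] H)
    (hAB : ∀ y h, inner ℝ (B y) h = inner ℝ y (A h)) (hA : Set.MapsTo A C C') {x : H} {y : H'}
    (hx : x ∈ C) (h : y ∈ regularNormalCone C' (A x)) : B y ∈ regularNormalCone C x := by
  refine ⟨hx, fun ε hε => ?_⟩
  have hT : Tendsto A (𝓝[C] x) (𝓝[C'] (A x)) :=
    (A.continuous.continuousWithinAt).tendsto_nhdsWithin hA
  filter_upwards [hT.eventually (h.2 (ε / (‖A‖ + 1)) (by positivity))] with c hc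
  rw [hAB, map_sub]
  refine hc.trans ?_
  rw [← map_sub, div_mul_eq_mul_div, div_le_iff₀ (by positivity), mul_assoc]
  gcongr
  nlinarith [A.le_opNorm (c - x), norm_nonneg (c - x)]

/-- `B` is the adjoint of `A`, so it pulls back regular normals at each approximating point. Those
points lie in `C'`; the inverse `A'` is what carries them back into `C`. -/
theorem limitingNormalCone_pullback {C : Set H} {C' : Set H'} (A : H →L[ℝ] H') (A' : H' →L[ℝ] H)
    (B : H' →L[ℝ] H) (hAB : ∀ y h, inner ℝ (B y) h = inner ℝ y (A h)) (hA : Set.MapsTo A C C')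
    (hA' : Set.MapsTo A' C' C) (hr : Function.RightInverse A' A) (hl : Function.LeftInverse A' A)
    {x : H} {y : H'} (h : y ∈ limitingNormalCone C' (A x)) : B y ∈ limitingNormalCone C x := by
  obtain ⟨hx, xs, ys, hxC, hxs, hys, hyl⟩ := h
  refine ⟨by simpa only [hl x] using hA' hx, fun i => A' (xs i), fun i => B (ys i),
    fun i => hA' (hxC i), ?_, fun i => ?_, (B.continuous.tendsto y).comp hyl⟩
  · have := (A'.continuous.tendsto (A x)).comp hxs
    rwa [hl x] at this
  · exact regularNormalCone_pullback A B hAB hA (hA' (hxC i)) (by rw [hr]; exact hys i)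

end NormalCones

/-! ### Penalty method over a compact set. -/

/-- Penalization over a compact set: minimizers of `f + j g` come close to a point
which is the only one of the zero set of `g` where `f ≤ 0`. -/
theorem exists_penalty_minimizer {E : Type*} [MetricSpace E] {K : Set E} (hK : IsCompact K)
    {f g : E → ℝ} (hf : Continuous f) (hg : Continuous g) (hg0 : ∀ k, 0 ≤ g k) {k₀ : E}
    (hk₀ : k₀ ∈ K) (hfk : f k₀ = 0) (hgk : g k₀ = 0)
    (huniq : ∀ k ∈ K, g k = 0 → f k ≤ 0 → k = k₀) {δ : ℝ} (hδ : 0 < δ) :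
    ∃ j : ℝ, 0 ≤ j ∧ ∃ k ∈ K, dist k k₀ < δ ∧ ∀ k' ∈ K, f k + j * g k ≤ f k' + j * g k' := by
  have hmin : ∀ j : ℕ, ∃ k ∈ K, ∀ k' ∈ K, f k + j * g k ≤ f k' + j * g k' := fun j =>
    hK.exists_isMinOn ⟨k₀, hk₀⟩ (f := fun k => f k + j * g k) (by fun_prop)
  choose k hkK hkmin using hmin
  obtain ⟨kl, hkl, φ, hφ, hlim⟩ := hK.tendsto_subseq hkK
  obtain ⟨m, -, hm⟩ := hK.exists_isMinOn ⟨k₀, hk₀⟩ hf.continuousOn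
  have hle : ∀ j, f (k j) + j * g (k j) ≤ 0 := fun j => by simpa [hfk, hgk] using hkmin j k₀ hk₀
  have hf0 : f kl ≤ 0 := le_of_tendsto ((hf.tendsto _).comp hlim) <| Eventually.of_forall fun i => by
    have h1 := hle (φ i)
    have h2 : 0 ≤ (φ i : ℝ) * g (k (φ i)) := mul_nonneg (Nat.cast_nonneg _) (hg0 _)
    simp only [Function.comp_apply]
    linarith
  have hgz : g kl = 0 := by
    refine le_antisymm ?_ (hg0 _)
    -- The penalized minimum is at most its value 0 at `k₀`, and `f` is at least `f m` on `K`, so g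
    -- ≤ -f m / j at the j-th minimizer.
    have hz : Tendsto (fun i => -f m / (φ i : ℝ)) atTop (𝓝 0) :=
      (tendsto_const_div_atTop_nhds_zero_nat (-f m)).comp hφ.tendsto_atTop
    refine le_of_tendsto_of_tendsto ((hg.tendsto _).comp hlim) hz ?_
    filter_upwards [eventually_ge_atTop 1] with i hi
    have hpos : (0 : ℝ) < φ i := by exact_mod_cast (Nat.lt_of_lt_of_le hi (hφ.id_le i))
    have h1 := hle (φ i)
    have h2 : f m ≤ f (k (φ i)) := hm (hkK (φ i))
    simp only [Function.comp_apply]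
    rw [le_div_iff₀ hpos]
    linarith
  rw [huniq kl hkl hgz hf0] at hlim
  obtain ⟨i, hi⟩ := (Metric.tendsto_nhds.1 hlim δ hδ).exists
  exact ⟨φ i, Nat.cast_nonneg _, k (φ i), hkK _, hi, hkmin (φ i)⟩

/-! ### Fuzzy and sequential chain rules. -/

section ChainRule

variable {X Y Z : Type*} [NormedAddCommGroup X] [InnerProductSpace ℝ X]
  [NormedAddCommGroup Y] [InnerProductSpace ℝ Y] [NormedAddCommGroup Z] [InnerProductSpace ℝ Z]

omit [InnerProductSpace ℝ X] [InnerProductSpace ℝ Y] in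
theorem isClosed_setOf_mem {S : SetMap X Y} (hS : IsClosed (svGraph S)) :
    IsClosed {z : X × Y | z.2 ∈ S z.1} :=
  hS.preimage (WithLp.prod_continuous_toLp 2 X Y)

theorem mem_svGraph {X Y : Type*} {S : SetMap X Y} {x : X} {y : Y} :
    WithLp.toLp 2 (x, y) ∈ svGraph S ↔ y ∈ S x := Iff.rfl

omit [InnerProductSpace ℝ X] [InnerProductSpace ℝ Y] in
theorem tendsto_toLp_prod {ι : Type*} {l : Filter ι} {x : ι → X} {y : ι → Y} {a : X} {b : Y}
    (hx : Tendsto x l (𝓝 a)) (hy : Tendsto y l (𝓝 b)) :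
    Tendsto (fun i => WithLp.toLp 2 (x i, y i)) l (𝓝 (WithLp.toLp 2 (a, b))) :=
  ((WithLp.prod_continuous_toLp 2 X Y).tendsto (a, b)).comp (hx.prodMk_nhds hy)

theorem inner_toLp_sub_toLp (v : X) (q : Y) (a x : X) (b y : Y) :
    inner ℝ (WithLp.toLp 2 (v, q)) (WithLp.toLp 2 (a, b) - WithLp.toLp 2 (x, y)) =
      inner ℝ v (a - x) + inner ℝ q (b - y) :=
  WithLp.prod_inner_apply _ _

omit [InnerProductSpace ℝ X] [InnerProductSpace ℝ Y] in
theorem norm_toLp_sub_toLp_sq (a x : X) (b y : Y) :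
    ‖WithLp.toLp 2 (a, b) - WithLp.toLp 2 (x, y)‖ ^ 2 = ‖a - x‖ ^ 2 + ‖b - y‖ ^ 2 :=
  WithLp.prod_norm_sq_eq_of_L2 _

theorem tendsto_of_dist_lt {E : Type*} [PseudoMetricSpace E] {a b : ℕ → E} {l : E} {ε : ℕ → ℝ}
    (hε : Tendsto ε atTop (𝓝 0)) (hb : Tendsto b atTop (𝓝 l))
    (h : ∀ i, dist (a i) (b i) < ε i) : Tendsto a atTop (𝓝 l) :=
  (tendsto_iff_of_dist (squeeze_zero (fun _ => dist_nonneg) (fun i => (h i).le) hε)).2 hb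

/-- This is the form in which minimality in one of the two decoupled pairs delivers a normal; `α`
and `β` may be large, since a regular normal only needs an error of smaller order than the distance.
-/
theorem mem_regularNormalCone_svGraph_of_quadratic {S : SetMap X Y} {x : X} {y : Y} {v : X} {q : Y}
    {α β : ℝ} (hα : 0 ≤ α) (hβ : 0 ≤ β) (hy : y ∈ S x)
    (h : ∀ᶠ z : X × Y in 𝓝 (x, y), z.2 ∈ S z.1 →
      inner ℝ v (z.1 - x) + inner ℝ q (z.2 - y) ≤ α * ‖z.1 - x‖ ^ 2 + β * ‖z.2 - y‖ ^ 2) :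
    WithLp.toLp 2 (v, q) ∈ regularNormalCone (svGraph S) (WithLp.toLp 2 (x, y)) := by
  refine mem_regularNormalCone_of_quadratic (σ := α + β) (mem_svGraph.2 hy) ?_
  have hT : Tendsto (fun z : WithLp 2 (X × Y) => (z.fst, z.snd)) (𝓝 (WithLp.toLp 2 (x, y)))
      (𝓝 (x, y)) := (WithLp.prod_continuous_ofLp 2 X Y).tendsto (WithLp.toLp 2 (x, y))
  rw [eventually_nhdsWithin_iff]
  filter_upwards [hT.eventually h] with z hz hzS
  have := hz hzS
  have e₁ := inner_toLp_sub_toLp v q z.fst x z.snd y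
  have e₂ := norm_toLp_sub_toLp_sq z.fst x z.snd y
  change inner ℝ _ (z - _) = _ at e₁
  change ‖z - _‖ ^ 2 = _ at e₂
  rw [e₁, e₂]
  refine this.trans ?_
  nlinarith [mul_nonneg hα (sq_nonneg ‖z.snd - y‖), mul_nonneg hβ (sq_nonneg ‖z.fst - x‖)]

variable [FiniteDimensional ℝ X] [FiniteDimensional ℝ Y] [FiniteDimensional ℝ Z]

/-- Fuzzy chain rule: a proximal normal to the graph of a composition is approximately the
combination of regular normals to the graphs of the factors at nearby points. -/
theorem exists_fuzzy_chain {S₁ : SetMap X Y} {S₂ : SetMap Y Z} (h₁ : IsClosed (svGraph S₁))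
    (h₂ : IsClosed (svGraph S₂)) {x : X} {w : Y} {u : Z} (hw : w ∈ S₁ x) (hu : u ∈ S₂ w)
    {v : X} {p : Z} {σ : ℝ} (hσ : 0 ≤ σ)
    (h : ∀ a, ∀ b ∈ S₁ a, ∀ c ∈ S₂ b,
      inner ℝ v (a - x) - inner ℝ p (c - u) ≤ σ * (‖a - x‖ ^ 2 + ‖c - u‖ ^ 2))
    {δ : ℝ} (hδ : 0 < δ) :
    ∃ (x' : X) (y₁ y₂ : Y) (z' : Z) (v' : X) (q₁ q₂ : Y) (p' : Z),
      dist x' x < δ ∧ dist y₁ w < δ ∧ dist y₂ w < δ ∧ dist z' u < δ ∧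
      dist v' v < δ ∧ dist q₁ q₂ < δ ∧ dist p' p < δ ∧
      WithLp.toLp 2 (v', -q₁) ∈ regularNormalCone (svGraph S₁) (WithLp.toLp 2 (x', y₁)) ∧
      WithLp.toLp 2 (q₂, -p') ∈ regularNormalCone (svGraph S₂) (WithLp.toLp 2 (y₂, z')) := by
  set k₀ : (X × Y) × (Y × Z) := ((x, w), (w, u)) with hk₀
  let K : Set ((X × Y) × (Y × Z)) :=
    Metric.closedBall k₀ 1 ∩ ({z | z.2 ∈ S₁ z.1} ×ˢ {z | z.2 ∈ S₂ z.1})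
  have hK : IsCompact K := (isCompact_closedBall _ _).inter_right
    ((isClosed_setOf_mem h₁).prod (isClosed_setOf_mem h₂))
  -- Taking σ + 1 instead of `σ`, and adding ‖b - w‖², makes (x, w, u) the only point with zero gap
  -- where `f` is nonpositive.
  let f : (X × Y) × (Y × Z) → ℝ := fun k => -inner ℝ v (k.1.1 - x) + inner ℝ p (k.2.2 - u) +
    (σ + 1) * (‖k.1.1 - x‖ ^ 2 + ‖k.2.2 - u‖ ^ 2) + ‖k.1.2 - w‖ ^ 2
  let g : (X × Y) × (Y × Z) → ℝ := fun k => ‖k.1.2 - k.2.1‖ ^ 2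
  have hσ1 : 0 < 2 * (σ + 1) + 2 := by positivity
  obtain ⟨j, hj, ⟨⟨x', y₁⟩, y₂, z'⟩, hkK, hdist, hmin⟩ :=
    exists_penalty_minimizer hK (f := f) (g := g) (k₀ := k₀) (by fun_prop) (by fun_prop)
      (fun k => by positivity)
      ⟨Metric.mem_closedBall_self zero_le_one, hw, hu⟩ (by simp [f, k₀]) (by simp [g, k₀])
      (by
        rintro ⟨⟨a, b⟩, b', c⟩ ⟨-, hab, hbc⟩ hg hf
        have hb : b = b' := by simpa [g, sub_eq_zero] using hg
        subst hb
        have := h a b hab c hbc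
        simp only [f] at hf
        have e1 : 0 ≤ ‖a - x‖ ^ 2 := sq_nonneg _
        have e2 : 0 ≤ ‖c - u‖ ^ 2 := sq_nonneg _
        have e3 : 0 ≤ ‖b - w‖ ^ 2 := sq_nonneg _
        have z1 : ‖a - x‖ ^ 2 = 0 := by linarith
        have z2 : ‖c - u‖ ^ 2 = 0 := by linarith
        have z3 : ‖b - w‖ ^ 2 = 0 := by linarith
        simp only [ne_eq, OfNat.ofNat_ne_zero, not_false_eq_true, pow_eq_zero_iff, norm_eq_zero,
          sub_eq_zero] at z1 z2 z3
        rw [hk₀, z1, z2, z3])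
      -- The bound 1 puts the minimizer in the interior of the ball defining `K`, so small
      -- variations stay admissible. The other bound absorbs the factors 2(σ + 1) and 2 from the
      -- derivatives of the quadratic terms.
      (δ := min 1 (δ / (2 * (σ + 1) + 2))) (by positivity)
  have hd1 := hdist.trans_le (min_le_left _ _)
  have hd2 := hdist.trans_le (min_le_right _ _)
  have hlt : δ / (2 * (σ + 1) + 2) ≤ δ := div_le_self hδ.le (by linarith)
  obtain ⟨-, hy₁, hz'⟩ := hkK
  simp only [hk₀, Prod.dist_eq, max_lt_iff] at hd2
  obtain ⟨⟨hx, hy1⟩, hy2, hz⟩ := hd2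
  -- The multipliers are partial gradients of f + j g. No bound on `j` is needed: the term 2j(y₁ -
  -- y₂) is common to `q₁` and `q₂`, which differ only by 2(y₁ - w).
  refine ⟨x', y₁, y₂, z', v - (2 * (σ + 1)) • (x' - x),
    (2 : ℝ) • (y₁ - w) + (2 * j) • (y₁ - y₂), (2 * j) • (y₁ - y₂),
    p + (2 * (σ + 1)) • (z' - u), hx.trans_le hlt, hy1.trans_le hlt, hy2.trans_le hlt,
    hz.trans_le hlt, ?_, ?_, ?_, ?_, ?_⟩
  · rw [dist_eq_norm, sub_sub_cancel_left, norm_neg, norm_smul, ← dist_eq_norm,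
      Real.norm_of_nonneg (by positivity)]
    rw [lt_div_iff₀ hσ1] at hx
    nlinarith [dist_nonneg (x := x') (y := x)]
  · rw [dist_eq_norm, add_sub_cancel_right, norm_smul, ← dist_eq_norm,
      Real.norm_of_nonneg (by positivity)]
    rw [lt_div_iff₀ hσ1] at hy1
    nlinarith [dist_nonneg (x := y₁) (y := w)]
  · rw [dist_eq_norm, add_sub_cancel_left, norm_smul, ← dist_eq_norm,
      Real.norm_of_nonneg (by positivity)]
    rw [lt_div_iff₀ hσ1] at hz
    nlinarith [dist_nonneg (x := z') (y := u)]
  · refine mem_regularNormalCone_svGraph_of_quadratic (α := σ + 1) (β := 1 + j) (by positivity)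
      (by positivity) hy₁ ?_
    have hc : Continuous fun z : X × Y => (z, (y₂, z')) := by fun_prop
    filter_upwards [hc.continuousAt.eventually (Metric.isOpen_ball.mem_nhds hd1)] with z hzb hzS
    have hm := hmin (z, (y₂, z')) ⟨Metric.ball_subset_closedBall hzb, hzS, hz'⟩
    simp only [f, g] at hm
    obtain ⟨a, b⟩ := z
    simp only at hm ⊢
    have ea : a - x = (a - x') + (x' - x) := by abel
    have eb : b - w = (b - y₁) + (y₁ - w) := by abel
    have ec : b - y₂ = (b - y₁) + (y₁ - y₂) := by abel
    rw [ea, eb, ec, norm_add_sq_real, norm_add_sq_real, norm_add_sq_real, inner_add_right,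
      real_inner_comm (x' - x) (a - x'), real_inner_comm (y₁ - w), real_inner_comm (y₁ - y₂)] at hm
    rw [inner_sub_left v, inner_neg_left, inner_add_left, real_inner_smul_left,
      real_inner_smul_left, real_inner_smul_left]
    linarith
  · refine mem_regularNormalCone_svGraph_of_quadratic (α := j) (β := σ + 1) (by positivity)
      (by positivity) hz' ?_
    have hc : Continuous fun z : Y × Z => ((x', y₁), z) := by fun_prop
    filter_upwards [hc.continuousAt.eventually (Metric.isOpen_ball.mem_nhds hd1)] with z hzb hzS
    have hm := hmin ((x', y₁), z) ⟨Metric.ball_subset_closedBall hzb, hy₁, hzS⟩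
    simp only [f, g] at hm
    obtain ⟨b, c⟩ := z
    simp only at hm ⊢
    have ea : c - u = (c - z') + (z' - u) := by abel
    have ec : y₁ - b = (y₁ - y₂) - (b - y₂) := by abel
    rw [ea, ec, norm_add_sq_real, norm_sub_sq_real (y₁ - y₂), inner_add_right,
      real_inner_comm (z' - u) (c - z')] at hm
    rw [inner_neg_left, inner_add_left, real_inner_smul_left, real_inner_smul_left]
    linarith

omit [FiniteDimensional ℝ X] [FiniteDimensional ℝ Y] in
/-- Regular normals to the graph of a Lipschitz set-valued map have a bounded slope. -/
theorem norm_le_of_mem_regularNormalCone_svGraph {S : SetMap X Y} {U : Set X} {κ : ℝ} (hκ : 0 ≤ κ)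
    (hS : ∀ x' ∈ U, ∀ x'' ∈ U, S x' ⊆ S x'' + Metric.closedBall (0 : Y) (κ * ‖x' - x''‖))
    {x : X} (hU : U ∈ 𝓝 x) {y : Y} {q : X} {p : Y}
    (h : WithLp.toLp 2 (q, p) ∈ regularNormalCone (svGraph S) (WithLp.toLp 2 (x, y))) :
    ‖q‖ ≤ κ * ‖p‖ := by
  rcases eq_or_ne q 0 with rfl | hq
  · simp; positivity
  have hqpos : 0 < ‖q‖ := norm_pos_iff.2 hq
  obtain ⟨hy, h⟩ := h
  -- The normal inequality is tested by moving the base point along `q` itself; the Lipschitz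
  -- property supplies a graph point over x + t q whose second component moves by at most κt‖q‖.
  have hpt : ∀ t : ℝ, 0 < t → x + t • q ∈ U →
      ∃ y' ∈ S (x + t • q), ‖y' - y‖ ≤ κ * (t * ‖q‖) := fun t ht htU => by
    obtain ⟨y', hy', b, hb, hyb⟩ := hS x (mem_of_mem_nhds hU) _ htU hy
    refine ⟨y', hy', ?_⟩
    have : y' - y = -b := by
      have hyb : y' + b = y := hyb
      rw [← hyb]; abel
    rw [this, norm_neg]
    simpa [norm_smul, abs_of_pos ht] using hb
  have key : ∀ ε : ℝ, 0 < ε → ‖q‖ ≤ κ * ‖p‖ + ε * (1 + κ) := fun ε hε => by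
    obtain ⟨r, hr, hball⟩ := Metric.mem_nhdsWithin_iff.1 (h ε hε)
    have hc : Continuous fun t : ℝ => x + t • q := by fun_prop
    have hU' : ∀ᶠ t : ℝ in 𝓝[>] 0, x + t • q ∈ U :=
      ((hc.tendsto 0).mono_left nhdsWithin_le_nhds).eventually (by simpa using hU)
    have hr' : ∀ᶠ t : ℝ in 𝓝[>] 0, t * (‖q‖ * (1 + κ)) < r := by
      have hc' : Continuous fun t : ℝ => t * (‖q‖ * (1 + κ)) := by fun_prop
      exact ((hc'.tendsto 0).mono_left nhdsWithin_le_nhds).eventually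
        (gt_mem_nhds (by simpa using hr))
    obtain ⟨t, ⟨htU, htr⟩, ht⟩ := ((hU'.and hr').and self_mem_nhdsWithin).exists
    have ht : 0 < t := ht
    obtain ⟨y', hy', hd⟩ := hpt t ht htU
    have hn : ‖WithLp.toLp 2 (x + t • q, y') - WithLp.toLp 2 (x, y)‖ ≤ t * (‖q‖ * (1 + κ)) := by
      refine le_of_sq_le_sq ?_ (by positivity)
      rw [norm_toLp_sub_toLp_sq, add_sub_cancel_left, norm_smul, Real.norm_of_nonneg ht.le]
      have h0 : 0 ≤ t * ‖q‖ := by positivity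
      have h1 : ‖y' - y‖ ^ 2 ≤ (κ * (t * ‖q‖)) ^ 2 := by gcongr
      nlinarith [mul_nonneg hκ (sq_nonneg (t * ‖q‖))]
    have hin : inner ℝ _ _ ≤ ε * _ := hball ⟨by rw [Metric.mem_ball, dist_eq_norm]; exact hn.trans_lt htr,
      mem_svGraph.2 hy'⟩
    rw [inner_toLp_sub_toLp, add_sub_cancel_left, real_inner_smul_right,
      real_inner_self_eq_norm_sq] at hin
    have h2 : -(‖p‖ * ‖y' - y‖) ≤ inner ℝ p (y' - y) :=
      (abs_le.1 (abs_real_inner_le_norm p (y' - y))).1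
    have h3 : ‖p‖ * ‖y' - y‖ ≤ ‖p‖ * (κ * (t * ‖q‖)) := by gcongr
    have h4 := mul_le_mul_of_nonneg_left hn hε.le
    have h5 : (t * ‖q‖) * ‖q‖ ≤ (t * ‖q‖) * (κ * ‖p‖ + ε * (1 + κ)) := by nlinarith
    exact le_of_mul_le_mul_left h5 (by positivity)
  refine le_of_forall_pos_le_add fun η hη => ?_
  have := key (η / (1 + κ)) (by positivity)
  rwa [div_mul_cancel₀ _ (by positivity)] at this

/-- Sequential chain rule: limits of proximal normals to the graph of `S₂ ∘ S₁` along a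
convergent sequence of intermediate points. -/
theorem exists_limiting_chain {S₁ : SetMap X Y} {S₂ : SetMap Y Z} (h₁ : IsClosed (svGraph S₁))
    (h₂ : IsClosed (svGraph S₂)) (hL : SVLocallyLipschitz S₂)
    {x : ℕ → X} {w : ℕ → Y} {u : ℕ → Z} {v : ℕ → X} {p : ℕ → Z} {σ : ℕ → ℝ}
    {xl : X} {wl : Y} {ul : Z} {vl : X} {pl : Z}
    (hx : Tendsto x atTop (𝓝 xl)) (hw : Tendsto w atTop (𝓝 wl)) (hu : Tendsto u atTop (𝓝 ul))
    (hv : Tendsto v atTop (𝓝 vl)) (hp : Tendsto p atTop (𝓝 pl))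
    (hwS : ∀ i, w i ∈ S₁ (x i)) (huS : ∀ i, u i ∈ S₂ (w i)) (hσ : ∀ i, 0 ≤ σ i)
    (h : ∀ i, ∀ a, ∀ b ∈ S₁ a, ∀ c ∈ S₂ b, inner ℝ (v i) (a - x i) - inner ℝ (p i) (c - u i) ≤
      σ i * (‖a - x i‖ ^ 2 + ‖c - u i‖ ^ 2)) :
    ∃ q, vl ∈ coderivative S₁ xl wl q ∧ q ∈ coderivative S₂ wl ul pl := by
  have hδ : Tendsto (fun i : ℕ => 1 / ((i : ℝ) + 1)) atTop (𝓝 0) :=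
    tendsto_one_div_add_atTop_nhds_zero_nat
  choose x' y₁ y₂ z' v' q₁ q₂ p' dx dy₁ dy₂ dz dv dq dp hn₁ hn₂ using fun i : ℕ =>
    exists_fuzzy_chain h₁ h₂ (hwS i) (huS i) (hσ i) (h i)
      (δ := 1 / ((i : ℝ) + 1)) (by positivity)
  have hx' := tendsto_of_dist_lt hδ hx dx
  have hy₁ := tendsto_of_dist_lt hδ hw dy₁
  have hy₂ := tendsto_of_dist_lt hδ hw dy₂
  have hz' := tendsto_of_dist_lt hδ hu dz
  have hv' := tendsto_of_dist_lt hδ hv dv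
  have hp' := tendsto_of_dist_lt hδ hp dp
  obtain ⟨U, hU, κ, hκ, hUL⟩ := hL.2 wl
  -- The Lipschitz estimate bounds `q₂` by `κ` times the norm of the convergent `p'`; compactness
  -- gives a limit, which `q₁` shares.
  have hbd : ∀ᶠ i in atTop, q₂ i ∈ Metric.closedBall (0 : Y) (κ * (‖pl‖ + 1)) := by
    filter_upwards [hy₂.eventually (eventually_mem_nhds_iff.2 hU),
      hp'.norm.eventually (gt_mem_nhds (lt_add_one ‖pl‖))] with i hi hi'
    rw [mem_closedBall_zero_iff]
    have := norm_le_of_mem_regularNormalCone_svGraph hκ hUL hi (hn₂ i)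
    rw [norm_neg] at this
    exact this.trans (by gcongr)
  obtain ⟨q, -, φ, hφ, hq₂⟩ :=
    tendsto_subseq_of_frequently_bounded Metric.isBounded_closedBall hbd.frequently
  have hφ' := hφ.tendsto_atTop
  have hq₁ := tendsto_of_dist_lt (hδ.comp hφ') hq₂ (fun i => dq (φ i))
  refine ⟨q, ⟨?_, _, _, fun i => (hn₁ (φ i)).1,
    tendsto_toLp_prod (hx'.comp hφ') (hy₁.comp hφ'), fun i => hn₁ (φ i),
    tendsto_toLp_prod (hv'.comp hφ') hq₁.neg⟩, ⟨?_, _, _, fun i => (hn₂ (φ i)).1,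
    tendsto_toLp_prod (hy₂.comp hφ') (hz'.comp hφ'), fun i => hn₂ (φ i),
    tendsto_toLp_prod hq₂ (hp'.comp hφ').neg⟩⟩
  · exact h₁.mem_of_tendsto (tendsto_toLp_prod hx' hy₁) (Eventually.of_forall fun i => (hn₁ i).1)
  · exact h₂.mem_of_tendsto (tendsto_toLp_prod hy₂ hz') (Eventually.of_forall fun i => (hn₂ i).1)

end ChainRule

/-! ### Closedness, boundedness and convexity of compositions; the exact chain rule. -/

section SetValued

variable {X Y Z : Type*} [NormedAddCommGroup X] [InnerProductSpace ℝ X]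
  [NormedAddCommGroup Y] [InnerProductSpace ℝ Y] [NormedAddCommGroup Z] [InnerProductSpace ℝ Z]

theorem mem_svComp {X Y Z : Type*} {S₁ : SetMap X Y} {S₂ : SetMap Y Z} {x : X} {z : Z} :
    z ∈ svComp S₂ S₁ x ↔ ∃ y ∈ S₁ x, z ∈ S₂ y := by
  simp [svComp]

omit [InnerProductSpace ℝ X] [InnerProductSpace ℝ Y] in
theorem SVLocallyLipschitz.isClosed_svGraph {S : SetMap X Y} (hS : SVLocallyLipschitz S) :
    IsClosed (svGraph S) := by
  refine IsSeqClosed.isClosed fun z zl hz hlim => ?_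
  have hlim' := ((WithLp.prod_continuous_ofLp 2 X Y).tendsto zl).comp hlim
  have hx : Tendsto (fun i => (z i).fst) atTop (𝓝 zl.fst) := (continuous_fst.tendsto _).comp hlim'
  have hy : Tendsto (fun i => (z i).snd) atTop (𝓝 zl.snd) := (continuous_snd.tendsto _).comp hlim'
  obtain ⟨U, hU, κ, hκ, hL⟩ := hS.2 zl.fst
  change zl.snd ∈ S zl.fst
  rw [← (hS.1 zl.fst).closure_eq, Metric.mem_closure_iff]
  intro ε hε
  have hκx : Tendsto (fun i => κ * ‖(z i).fst - zl.fst‖) atTop (𝓝 0) := by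
    simpa using ((hx.sub_const zl.fst).norm.const_mul κ)
  obtain ⟨i, ⟨hiU, hi1⟩, hi2⟩ := ((hx.eventually hU).and
    (hκx.eventually (gt_mem_nhds (half_pos hε)))).and
    (Metric.tendsto_nhds.1 hy (ε / 2) (half_pos hε)) |>.exists
  obtain ⟨s, hs, b, hb, hsb⟩ := hL _ hiU _ (mem_of_mem_nhds hU) (hz i)
  refine ⟨s, hs, ?_⟩
  have hsb : s + b = (z i).snd := hsb
  have h1 : dist (z i).snd s ≤ κ * ‖(z i).fst - zl.fst‖ := by
    rw [← hsb, dist_eq_norm, add_sub_cancel_left]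
    simpa using hb
  linarith [dist_triangle_left zl.snd s (z i).snd]

omit [InnerProductSpace ℝ X] in
theorem SVLocallyBounded.exists_tendsto_subseq [FiniteDimensional ℝ Y] {S : SetMap X Y}
    (hS : SVLocallyBounded S) {x : ℕ → X} {w : ℕ → Y} {xl : X} (hx : Tendsto x atTop (𝓝 xl))
    (hw : ∀ i, w i ∈ S (x i)) :
    ∃ (wl : Y) (φ : ℕ → ℕ), StrictMono φ ∧ Tendsto (w ∘ φ) atTop (𝓝 wl) := by
  obtain ⟨U, hU, R, hR⟩ := hS xl
  obtain ⟨wl, -, φ, hφ, hlim⟩ := tendsto_subseq_of_frequently_bounded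
    (Metric.isBounded_closedBall (x := (0 : Y)) (r := R))
    ((hx.eventually hU).mono fun i hi => hR _ hi (hw i)).frequently
  exact ⟨wl, φ, hφ, hlim⟩

-- Local boundedness of `S₁` is essential: it makes the intermediate points of a convergent sequence
-- subconverge.
omit [InnerProductSpace ℝ X] [InnerProductSpace ℝ Z] in
theorem isClosed_svGraph_svComp [FiniteDimensional ℝ Y] {S₁ : SetMap X Y} {S₂ : SetMap Y Z}
    (h₁ : IsClosed (svGraph S₁)) (hb : SVLocallyBounded S₁) (h₂ : IsClosed (svGraph S₂)) :
    IsClosed (svGraph (svComp S₂ S₁)) := by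
  refine IsSeqClosed.isClosed fun z zl hz hlim => ?_
  have hlim' := ((WithLp.prod_continuous_ofLp 2 X Z).tendsto zl).comp hlim
  have hx : Tendsto (fun i => (z i).fst) atTop (𝓝 zl.fst) := (continuous_fst.tendsto _).comp hlim'
  have hy : Tendsto (fun i => (z i).snd) atTop (𝓝 zl.snd) := (continuous_snd.tendsto _).comp hlim'
  choose w hw hzw using fun i => mem_svComp.1 (hz i)
  obtain ⟨wl, φ, hφ, hwl⟩ := hb.exists_tendsto_subseq hx hw
  refine mem_svComp.2 ⟨wl, ?_, ?_⟩
  · exact h₁.mem_of_tendsto (tendsto_toLp_prod (hx.comp hφ.tendsto_atTop) hwl)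
      (Eventually.of_forall fun i => hw (φ i))
  · exact h₂.mem_of_tendsto (tendsto_toLp_prod hwl (hy.comp hφ.tendsto_atTop))
      (Eventually.of_forall fun i => hzw (φ i))

omit [InnerProductSpace ℝ Y] [InnerProductSpace ℝ Z] in
theorem SVLocallyBounded.exists_bound_of_isCompact {S : SetMap Y Z} (hS : SVLocallyBounded S)
    {K : Set Y} (hK : IsCompact K) : ∃ R : ℝ, ∀ y ∈ K, S y ⊆ Metric.closedBall (0 : Z) R := by
  refine hK.induction_on (p := fun s => ∃ R : ℝ, ∀ y ∈ s, S y ⊆ Metric.closedBall (0 : Z) R)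
    ⟨0, by simp⟩ (fun s t hst ⟨R, hR⟩ => ⟨R, fun y hy => hR y (hst hy)⟩)
    (fun s t ⟨R, hR⟩ ⟨R', hR'⟩ => ⟨max R R', ?_⟩) (fun y _ => ?_)
  · rintro y (hy | hy)
    · exact (hR y hy).trans (Metric.closedBall_subset_closedBall (le_max_left _ _))
    · exact (hR' y hy).trans (Metric.closedBall_subset_closedBall (le_max_right _ _))
  · obtain ⟨U, hU, R, hR⟩ := hS y
    exact ⟨U, mem_nhdsWithin_of_mem_nhds hU, R, hR⟩

omit [InnerProductSpace ℝ X] [InnerProductSpace ℝ Z] in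
theorem SVLocallyBounded.svComp [FiniteDimensional ℝ Y] {S₁ : SetMap X Y} {S₂ : SetMap Y Z}
    (h₁ : SVLocallyBounded S₁) (h₂ : SVLocallyBounded S₂) : SVLocallyBounded (svComp S₂ S₁) := by
  intro x
  obtain ⟨U, hU, R, hR⟩ := h₁ x
  obtain ⟨R', hR'⟩ := h₂.exists_bound_of_isCompact (isCompact_closedBall (0 : Y) R)
  refine ⟨U, hU, R', fun x' hx' z hz => ?_⟩
  obtain ⟨y, hy, hzy⟩ := mem_svComp.1 hz
  exact hR' y (hR x' hx' hy) hzy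

theorem GraphConvex.svComp {S₁ : SetMap X Y} {S₂ : SetMap Y Z} (h₁ : GraphConvex S₁)
    (h₂ : GraphConvex S₂) : GraphConvex (svComp S₂ S₁) := by
  intro z hz z' hz' a b ha hb hab
  obtain ⟨y, hy, hzy⟩ := mem_svComp.1 hz
  obtain ⟨y', hy', hzy'⟩ := mem_svComp.1 hz'
  exact mem_svComp.2 ⟨a • y + b • y',
    h₁ (mem_svGraph.2 hy) (mem_svGraph.2 hy') ha hb hab,
    h₂ (mem_svGraph.2 hzy) (mem_svGraph.2 hzy') ha hb hab⟩

theorem inner_le_inner_of_mem_coderivative {S : SetMap X Y} (hS : GraphConvex S) {x : X} {y : Y}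
    {v : X} {p : Y} (h : v ∈ coderivative S x y p) {a : X} {b : Y} (hab : b ∈ S a) :
    inner ℝ v (a - x) ≤ inner ℝ p (b - y) := by
  have := inner_le_zero_of_mem_limitingNormalCone hS h (mem_svGraph.2 hab)
  rw [inner_toLp_sub_toLp, inner_neg_left] at this
  linarith

theorem mem_coderivative_of_inner_le_inner {S : SetMap X Y} {x : X} {y : Y} (hy : y ∈ S x) {v : X}
    {p : Y} (h : ∀ a, ∀ b ∈ S a, inner ℝ v (a - x) ≤ inner ℝ p (b - y)) :
    v ∈ coderivative S x y p := by
  refine mem_limitingNormalCone_of_inner_le_zero (mem_svGraph.2 hy) fun c hc => ?_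
  have e := inner_toLp_sub_toLp v (-p) c.fst x c.snd y
  change inner ℝ _ (c - _) = _ at e
  rw [e, inner_neg_left]
  linarith [h c.fst c.snd hc]

variable [FiniteDimensional ℝ X] [FiniteDimensional ℝ Y] [FiniteDimensional ℝ Z]

/-- Coderivative chain rule for the composition with a locally Lipschitz outer map. -/
theorem coderivative_svComp {S₁ : SetMap X Y} {S₂ : SetMap Y Z} (h₁ : IsClosed (svGraph S₁))
    (hb : SVLocallyBounded S₁) (hL : SVLocallyLipschitz S₂) {x : X} {u : Z} {v : X} {p : Z}
    (h : v ∈ coderivative (svComp S₂ S₁) x u p) :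
    ∃ w ∈ S₁ x, u ∈ S₂ w ∧ ∃ q, v ∈ coderivative S₁ x w q ∧ q ∈ coderivative S₂ w u p := by
  have h₂ := hL.isClosed_svGraph
  have hC := isClosed_svGraph_svComp h₁ hb h₂
  have hδ : Tendsto (fun i : ℕ => 1 / ((i : ℝ) + 1)) atTop (𝓝 0) :=
    tendsto_one_div_add_atTop_nhds_zero_nat
  choose z hz n σ hσ hzx hn hq using fun i : ℕ =>
    exists_proximal_near_limiting hC h (δ := 1 / ((i : ℝ) + 1)) (by positivity)
  have hzl : Tendsto z atTop (𝓝 (WithLp.toLp 2 (x, u))) :=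
    tendsto_of_dist_lt hδ tendsto_const_nhds fun i => by rw [dist_eq_norm]; exact hzx i
  have hnl : Tendsto n atTop (𝓝 (WithLp.toLp 2 (v, -p))) :=
    tendsto_of_dist_lt hδ tendsto_const_nhds fun i => by rw [dist_eq_norm]; exact hn i
  have hzl' := ((WithLp.prod_continuous_ofLp 2 X Z).tendsto _).comp hzl
  have hnl' := ((WithLp.prod_continuous_ofLp 2 X Z).tendsto _).comp hnl
  have hx : Tendsto (fun i => (z i).fst) atTop (𝓝 x) := (continuous_fst.tendsto _).comp hzl'
  have hu : Tendsto (fun i => (z i).snd) atTop (𝓝 u) := (continuous_snd.tendsto _).comp hzl'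
  have hv : Tendsto (fun i => (n i).fst) atTop (𝓝 v) := (continuous_fst.tendsto _).comp hnl'
  have hp : Tendsto (fun i => -(n i).snd) atTop (𝓝 p) := by
    simpa using ((continuous_snd.tendsto _).comp hnl').neg
  choose w hw hzw using fun i => mem_svComp.1 (hz i)
  obtain ⟨wl, φ, hφ, hwl⟩ := hb.exists_tendsto_subseq hx hw
  have hφ' := hφ.tendsto_atTop
  refine ⟨wl, ?_, ?_, exists_limiting_chain h₁ h₂ hL (hx.comp hφ') hwl (hu.comp hφ')
    (hv.comp hφ') (hp.comp hφ') (fun i => hw (φ i)) (fun i => hzw (φ i)) (fun i => hσ (φ i)) ?_⟩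
  · exact h₁.mem_of_tendsto (tendsto_toLp_prod (hx.comp hφ') hwl)
      (Eventually.of_forall fun i => hw (φ i))
  · exact h₂.mem_of_tendsto (tendsto_toLp_prod hwl (hu.comp hφ'))
      (Eventually.of_forall fun i => hzw (φ i))
  · intro i a b hab c hbc
    have := hq (φ i) (WithLp.toLp 2 (a, c)) (mem_svComp.2 ⟨b, hab, hbc⟩)
    have e₁ := inner_toLp_sub_toLp (n (φ i)).fst (n (φ i)).snd a (z (φ i)).fst c (z (φ i)).snd
    have e₂ := norm_toLp_sub_toLp_sq a (z (φ i)).fst c (z (φ i)).snd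
    change inner ℝ (n (φ i)) (_ - z (φ i)) = _ at e₁
    change ‖_ - z (φ i)‖ ^ 2 = _ at e₂
    rw [e₁, e₂] at this
    simpa [inner_neg_left] using this

/-- In the graph convex case the chain rule holds at every intermediate point. -/
theorem coderivative_svComp_of_graphConvex {S₁ : SetMap X Y} {S₂ : SetMap Y Z}
    (h₁ : IsClosed (svGraph S₁)) (hL : SVLocallyLipschitz S₂) (hc : GraphConvex (svComp S₂ S₁))
    {x : X} {w : Y} {u : Z} (hw : w ∈ S₁ x) (hu : u ∈ S₂ w) {v : X} {p : Z}
    (h : v ∈ coderivative (svComp S₂ S₁) x u p) :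
    ∃ q, v ∈ coderivative S₁ x w q ∧ q ∈ coderivative S₂ w u p := by
  -- Convexity gives the normal inequality globally with zero quadratic error, so constant sequences
  -- based at the prescribed `w` suffice.
  refine exists_limiting_chain h₁ hL.isClosed_svGraph hL (σ := fun _ => 0) tendsto_const_nhds
    tendsto_const_nhds tendsto_const_nhds tendsto_const_nhds tendsto_const_nhds (fun _ => hw)
    (fun _ => hu) (fun _ => le_rfl) fun _ a b hab c hbc => ?_
  have := inner_le_inner_of_mem_coderivative hc h (mem_svComp.2 ⟨b, hab, hbc⟩)
  linarith

end SetValued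

/-! ### Finite compositions, paths and adjoint sequences. -/

section Chains

/-- End points of the discrete paths of a finite sequence of set-valued maps. -/
def chainReach {X : Type*} (N : ℕ) (M : Fin N → SetMap X X) : SetMap X X :=
  fun x₀ => {xN | ∃ x : Fin (N + 1) → X,
    (∀ k : Fin N, x k.succ ∈ M k (x k.castSucc)) ∧ x 0 = x₀ ∧ x (Fin.last N) = xN}

theorem chainReach_zero {X : Type*} (M : Fin 0 → SetMap X X) (x : X) :
    chainReach 0 M x = {x} := by
  ext y
  constructor
  · rintro ⟨z, -, h0, h1⟩
    exact h1.symm.trans h0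
  · rintro rfl
    exact ⟨fun _ => y, fun k => k.elim0, rfl, rfl⟩

/-- Peeling off the last map leaves a single Lipschitz map as outer factor; the inner chain then
needs only a closed graph and local boundedness, which `chainReach_closed_bounded` propagates. -/
theorem chainReach_succ {X : Type*} (N : ℕ) (M : Fin (N + 1) → SetMap X X) :
    chainReach (N + 1) M =
      svComp (M (Fin.last N)) (chainReach N fun k => M k.castSucc) := by
  ext x₀ y
  rw [mem_svComp]
  constructor
  · rintro ⟨x, hx, h0, h1⟩
    refine ⟨x (Fin.last N).castSucc, ⟨fun k => x k.castSucc, fun k => ?_, h0, rfl⟩, ?_⟩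
    · exact hx k.castSucc
    · rw [← h1]
      exact hx (Fin.last N)
  · rintro ⟨w, ⟨x, hx, h0, h1⟩, hy⟩
    refine ⟨Fin.snoc (α := fun _ => X) x y, fun k => ?_, ?_, by simp⟩
    · induction k using Fin.lastCases with
      | last => simpa [h1] using hy
      | cast k =>
        simpa only [Fin.succ_castSucc, Fin.snoc_castSucc] using hx k
    · rw [← Fin.castSucc_zero, Fin.snoc_castSucc, h0]

/-- The reversal appears because the factor of index 0 in `svCompChain` is the outermost, whereas `M
0` acts first. -/
theorem chainReach_eq_svCompChain {X : Type*} (N : ℕ) (M : Fin N → SetMap X X) :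
    chainReach N M = svCompChain N fun k => M k.rev := by
  induction N with
  | zero =>
    funext x
    exact chainReach_zero M x
  | succ N ih =>
    rw [chainReach_succ, ih, svCompChain]
    simp [Fin.rev_succ]

theorem mem_svCompChain {X : Type*} {N : ℕ} {D : Fin N → SetMap X X} {x y : X} :
    y ∈ svCompChain N D x ↔ ∃ q : Fin (N + 1) → X,
      q 0 = y ∧ q (Fin.last N) = x ∧ ∀ k : Fin N, q k.castSucc ∈ D k (q k.succ) := by
  induction N generalizing x y with
  | zero =>
    constructor
    · intro h
      exact ⟨fun _ => y, rfl, h, fun k => k.elim0⟩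
    · rintro ⟨q, h0, h1, -⟩
      exact h0.symm.trans h1
  | succ N ih =>
    rw [svCompChain, mem_svComp]
    constructor
    · rintro ⟨z, hz, hy⟩
      obtain ⟨q, h0, h1, hq⟩ := ih.1 hz
      refine ⟨Fin.cons (α := fun _ => X) y q, rfl, ?_, fun k => ?_⟩
      · rw [← Fin.succ_last, Fin.cons_succ, h1]
      · induction k using Fin.cases with
        | zero => simpa [h0] using hy
        | succ k =>
          rw [← Fin.succ_castSucc]
          simpa using hq k
    · rintro ⟨q, h0, h1, hq⟩
      refine ⟨q 1, ih.2 ⟨fun k => q k.succ, rfl, ?_, fun k => ?_⟩, ?_⟩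
      · exact h1
      · exact hq k.succ
      · rw [← h0]
        exact hq 0

variable {X : Type*} [NormedAddCommGroup X] [InnerProductSpace ℝ X]

theorem coderivative_of_eq_singleton {S : SetMap X X} (hS : ∀ x, S x = {x}) {x y v p : X}
    (h : v ∈ coderivative S x y p) : v = p := by
  have hmem : ∀ z : WithLp 2 (X × X), z ∈ svGraph S ↔ z.snd = z.fst := fun z => by
    change z.snd ∈ S z.fst ↔ _
    rw [hS, Set.mem_singleton_iff]
  have hconv : GraphConvex S := by
    intro z hz z' hz' a b _ _ _
    rw [hmem] at *
    change a • z.snd + b • z'.snd = a • z.fst + b • z'.fst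
    rw [hz, hz']
  have hxy : y = x := (hmem _).1 h.1
  -- The graph is the diagonal; displacing both components by v - p turns the normal inequality into
  -- ‖v - p‖² ≤ 0.
  have := inner_le_inner_of_mem_coderivative hconv h (a := x + (v - p)) (b := x + (v - p))
    (by rw [hS]; rfl)
  rw [hxy, add_sub_cancel_left, ← sub_nonpos, ← inner_sub_left] at this
  rw [real_inner_self_eq_norm_sq] at this
  exact sub_eq_zero.1 (norm_eq_zero.1 (pow_eq_zero_iff two_ne_zero |>.1
    (le_antisymm this (sq_nonneg _))))

theorem graphConvex_chainReach {N : ℕ} {M : Fin N → SetMap X X} (hM : ∀ k, GraphConvex (M k)) :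
    GraphConvex (chainReach N M) := by
  induction N with
  | zero =>
    intro z hz z' hz' a b _ _ _
    have hmem : ∀ z : WithLp 2 (X × X), z ∈ svGraph (chainReach 0 M) ↔ z.snd = z.fst := fun z => by
      change z.snd ∈ chainReach 0 M z.fst ↔ _
      rw [chainReach_zero, Set.mem_singleton_iff]
    rw [hmem] at *
    change a • z.snd + b • z'.snd = a • z.fst + b • z'.fst
    rw [hz, hz']
  | succ N ih =>
    rw [chainReach_succ]
    exact (ih fun k => hM k.castSucc).svComp (hM _)

/-- For a competing path x', convexity makes ⟪q k, x' k - x k⟫ nondecreasing in `k`; comparing its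
two ends is the normal inequality for the chain. -/
theorem mem_coderivative_chainReach_of_graphConvex {N : ℕ} {M : Fin N → SetMap X X}
    (hM : ∀ k, GraphConvex (M k)) {x q : Fin (N + 1) → X}
    (hx : ∀ k : Fin N, x k.succ ∈ M k (x k.castSucc))
    (hq : ∀ k : Fin N, q k.castSucc ∈
      coderivative (M k) (x k.castSucc) (x k.succ) (q k.succ)) :
    q 0 ∈ coderivative (chainReach N M) (x 0) (x (Fin.last N)) (q (Fin.last N)) := by
  have hmem : x (Fin.last N) ∈ chainReach N M (x 0) := ⟨x, hx, rfl, rfl⟩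
  refine mem_coderivative_of_inner_le_inner hmem ?_
  rintro a b ⟨x', hx', rfl, rfl⟩
  have : ∀ k, inner ℝ (q 0) (x' 0 - x 0) ≤ inner ℝ (q k) (x' k - x k) := fun k => by
    induction k using Fin.induction with
    | zero => exact le_rfl
    | succ k ih => exact ih.trans (inner_le_inner_of_mem_coderivative (hM k) (hq k) (hx' k))
  exact this _

theorem snoc_adjoint {N : ℕ} {M : Fin (N + 1) → SetMap X X} {x q : Fin (N + 1) → X} {y p : X}
    (hq : ∀ k : Fin N, q k.castSucc ∈
      coderivative (M k.castSucc) (x k.castSucc) (x k.succ) (q k.succ))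
    (hl : q (Fin.last N) ∈ coderivative (M (Fin.last N)) (x (Fin.last N)) y p)
    (k : Fin (N + 1)) :
    Fin.snoc (α := fun _ => X) q p k.castSucc ∈
      coderivative (M k) (Fin.snoc (α := fun _ => X) x y k.castSucc)
        (Fin.snoc (α := fun _ => X) x y k.succ) (Fin.snoc (α := fun _ => X) q p k.succ) := by
  induction k using Fin.lastCases with
  | last => simpa using hl
  | cast k =>
    simpa only [Fin.succ_castSucc, Fin.snoc_castSucc] using hq k

variable [FiniteDimensional ℝ X]

theorem chainReach_closed_bounded {N : ℕ} {M : Fin N → SetMap X X}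
    (hL : ∀ k, SVLocallyLipschitz (M k)) (hB : ∀ k, SVLocallyBounded (M k)) :
    IsClosed (svGraph (chainReach N M)) ∧ SVLocallyBounded (chainReach N M) := by
  induction N with
  | zero =>
    constructor
    · refine SVLocallyLipschitz.isClosed_svGraph ⟨fun x => ?_, fun x =>
        ⟨Set.univ, univ_mem, 1, zero_le_one, fun x' _ x'' _ => ?_⟩⟩
      · rw [chainReach_zero]
        exact isClosed_singleton
      · rw [chainReach_zero, chainReach_zero, Set.singleton_subset_iff]
        exact ⟨x'', rfl, x' - x'', by simp, by simp⟩
    · intro x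
      refine ⟨Metric.closedBall x 1, Metric.closedBall_mem_nhds x one_pos, ‖x‖ + 1,
        fun x' hx' => ?_⟩
      rw [chainReach_zero, Set.singleton_subset_iff, mem_closedBall_zero_iff]
      rw [mem_closedBall_iff_norm] at hx'
      linarith [norm_le_norm_add_norm_sub' x' x]
  | succ N ih =>
    obtain ⟨h1, h2⟩ := ih (fun k => hL k.castSucc) (fun k => hB k.castSucc)
    rw [chainReach_succ]
    exact ⟨isClosed_svGraph_svComp h1 h2 (hL _).isClosed_svGraph, h2.svComp (hB _)⟩

theorem exists_adjoint_of_graphConvex {N : ℕ} {M : Fin N → SetMap X X}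
    (hL : ∀ k, SVLocallyLipschitz (M k)) (hB : ∀ k, SVLocallyBounded (M k))
    (hc : ∀ k, GraphConvex (M k)) {x : Fin (N + 1) → X}
    (hx : ∀ k : Fin N, x k.succ ∈ M k (x k.castSucc)) {v p : X}
    (h : v ∈ coderivative (chainReach N M) (x 0) (x (Fin.last N)) p) :
    ∃ q : Fin (N + 1) → X, q 0 = v ∧ q (Fin.last N) = p ∧ ∀ k : Fin N, q k.castSucc ∈
      coderivative (M k) (x k.castSucc) (x k.succ) (q k.succ) := by
  induction N generalizing p with
  | zero =>
    have := coderivative_of_eq_singleton (chainReach_zero M) h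
    exact ⟨fun _ => v, rfl, this, fun k => k.elim0⟩
  | succ N ih =>
    have hconv := graphConvex_chainReach hc
    rw [chainReach_succ] at h hconv
    obtain ⟨q', h1, h2⟩ := coderivative_svComp_of_graphConvex
      (chainReach_closed_bounded (fun k => hL k.castSucc) (fun k => hB k.castSucc)).1 (hL _) hconv
      (w := x (Fin.last N).castSucc) ⟨fun k => x k.castSucc, fun k => hx k.castSucc, rfl, rfl⟩
      (hx (Fin.last N)) h
    obtain ⟨q, hq0, hql, hq⟩ := ih (M := fun k => M k.castSucc) (fun k => hL k.castSucc)
      (fun k => hB k.castSucc) (fun k => hc k.castSucc) (x := fun k => x k.castSucc)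
      (fun k => hx k.castSucc) h1
    have := snoc_adjoint (M := M) (x := fun k => x k.castSucc) (y := x (Fin.last (N + 1)))
      (p := p) hq (by rw [hql]; exact h2)
    have hxs : Fin.snoc (α := fun _ => X) (fun k : Fin (N + 1) => x k.castSucc)
        (x (Fin.last (N + 1))) = x := Fin.snoc_init_self x
    rw [hxs] at this
    refine ⟨Fin.snoc (α := fun _ => X) q p, ?_, by simp, this⟩
    rw [← Fin.castSucc_zero, Fin.snoc_castSucc, hq0]

theorem exists_path_adjoint {N : ℕ} {M : Fin N → SetMap X X}
    (hL : ∀ k, SVLocallyLipschitz (M k)) (hB : ∀ k, SVLocallyBounded (M k)) {x₀ xN v p : X}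
    (h : v ∈ coderivative (chainReach N M) x₀ xN p) :
    ∃ x : Fin (N + 1) → X, (∀ k : Fin N, x k.succ ∈ M k (x k.castSucc)) ∧ x 0 = x₀ ∧
      x (Fin.last N) = xN ∧ ∃ q : Fin (N + 1) → X, q 0 = v ∧ q (Fin.last N) = p ∧
        ∀ k : Fin N, q k.castSucc ∈
          coderivative (M k) (x k.castSucc) (x k.succ) (q k.succ) := by
  induction N generalizing xN p with
  | zero =>
    have := coderivative_of_eq_singleton (chainReach_zero M) h
    have hx : xN ∈ chainReach 0 M x₀ := h.1
    rw [chainReach_zero] at hx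
    exact ⟨fun _ => x₀, fun k => k.elim0, rfl, hx.symm, fun _ => v, rfl, this, fun k => k.elim0⟩
  | succ N ih =>
    rw [chainReach_succ] at h
    obtain ⟨hcl, hbd⟩ :=
      chainReach_closed_bounded (fun k => hL k.castSucc) (fun k => hB k.castSucc)
    -- Membership of `w` in the truncated chain is dropped: the path to `w` must be the one the
    -- induction hypothesis extracts from `h1`, together with its multipliers.
    obtain ⟨w, -, hu, q', h1, h2⟩ := coderivative_svComp hcl hbd (hL _) h
    obtain ⟨x, hx, hx0, hxl, q, hq0, hql, hq⟩ := ih (M := fun k => M k.castSucc)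
      (fun k => hL k.castSucc) (fun k => hB k.castSucc) h1
    refine ⟨Fin.snoc (α := fun _ => X) x xN, fun k => ?_, ?_, by simp,
      Fin.snoc (α := fun _ => X) q p, ?_, by simp,
      snoc_adjoint hq (by rw [hql, hxl]; exact h2)⟩
    · induction k using Fin.lastCases with
      | last => simpa [hxl] using hu
      | cast k =>
        simpa only [Fin.succ_castSucc, Fin.snoc_castSucc] using hx k
    · rw [← Fin.castSucc_zero, Fin.snoc_castSucc, hx0]
    · rw [← Fin.castSucc_zero, Fin.snoc_castSucc, hq0]

end Chains

/-! ### The Euler step as a shear of the graph. -/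

section Euler

variable {X : Type*} [NormedAddCommGroup X] [InnerProductSpace ℝ X]

/-- The map `x ↦ x + h S(x)`. -/
def eulerMap (h : ℝ) (S : SetMap X X) : SetMap X X :=
  fun x => (fun w => x + h • w) '' S x

theorem mem_eulerMap {h : ℝ} (hh : 0 < h) {S : SetMap X X} {x y : X} :
    y ∈ eulerMap h S x ↔ h⁻¹ • (y - x) ∈ S x := by
  constructor
  · rintro ⟨w, hw, rfl⟩
    simpa [inv_smul_smul₀ hh.ne'] using hw
  · intro hy
    exact ⟨_, hy, by simp [smul_inv_smul₀ hh.ne']⟩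

theorem SVLocallyLipschitz.eulerMap {h : ℝ} (hh : 0 < h) {S : SetMap X X}
    (hS : SVLocallyLipschitz S) : SVLocallyLipschitz (eulerMap h S) := by
  refine ⟨fun x => ?_, fun x => ?_⟩
  · have : _root_.eulerMap h S x = (fun y => h⁻¹ • (y - x)) ⁻¹' S x :=
      Set.ext fun y => mem_eulerMap hh
    rw [this]
    exact (hS.1 x).preimage (by fun_prop)
  · obtain ⟨U, hU, κ, hκ, hL⟩ := hS.2 x
    refine ⟨U, hU, 1 + h * κ, by positivity, ?_⟩
    rintro x' hx' x'' hx'' _ ⟨w, hw, rfl⟩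
    obtain ⟨s, hs, b, hb, rfl⟩ := hL x' hx' x'' hx'' hw
    refine ⟨x'' + h • s, ⟨s, hs, rfl⟩, (x' - x'') + h • b, ?_, ?_⟩
    · rw [mem_closedBall_zero_iff] at hb ⊢
      calc ‖x' - x'' + h • b‖ ≤ ‖x' - x''‖ + h * ‖b‖ := by
            refine (norm_add_le _ _).trans_eq ?_
            rw [norm_smul, Real.norm_of_nonneg hh.le]
        _ ≤ ‖x' - x''‖ + h * (κ * ‖x' - x''‖) := by gcongr
        _ = _ := by ring
    · simp only [smul_add]
      abel

theorem SVLocallyBounded.eulerMap {h : ℝ} (hh : 0 < h) {S : SetMap X X}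
    (hS : SVLocallyBounded S) : SVLocallyBounded (eulerMap h S) := by
  intro x
  obtain ⟨U, hU, R, hR⟩ := hS x
  refine ⟨U ∩ Metric.closedBall x 1, inter_mem hU (Metric.closedBall_mem_nhds x one_pos),
    ‖x‖ + 1 + h * R, ?_⟩
  rintro x' ⟨hx', hx'1⟩ _ ⟨w, hw, rfl⟩
  have hw' := hR x' hx' hw
  rw [mem_closedBall_zero_iff] at hw' ⊢
  rw [mem_closedBall_iff_norm] at hx'1
  have h1 : ‖x' + h • w‖ ≤ ‖x'‖ + h * ‖w‖ := by
    refine (norm_add_le _ _).trans_eq ?_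
    rw [norm_smul, Real.norm_of_nonneg hh.le]
  have h2 : h * ‖w‖ ≤ h * R := by gcongr
  linarith [norm_le_norm_add_norm_sub' x' x]

theorem GraphConvex.eulerMap {h : ℝ} (hh : 0 < h) {S : SetMap X X}
    (hS : GraphConvex S) : GraphConvex (eulerMap h S) := by
  intro z hz z' hz' a b ha hb hab
  have hz := (mem_eulerMap hh).1 hz
  have hz' := (mem_eulerMap hh).1 hz'
  have := hS (mem_svGraph.2 hz) (mem_svGraph.2 hz') ha hb hab
  refine (mem_eulerMap hh).2 ?_
  have e : h⁻¹ • ((a • z + b • z').snd - (a • z + b • z').fst) =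
      a • h⁻¹ • (z.snd - z.fst) + b • h⁻¹ • (z'.snd - z'.fst) := by
    change h⁻¹ • ((a • z.snd + b • z'.snd) - (a • z.fst + b • z'.fst)) = _
    module
  rw [e]
  exact this

variable [FiniteDimensional ℝ X]

/-- The linear map `(x, w) ↦ (x, c x + h w)`. -/
noncomputable def shear (X : Type*) [NormedAddCommGroup X] [InnerProductSpace ℝ X]
    [FiniteDimensional ℝ X] (c h : ℝ) : WithLp 2 (X × X) →L[ℝ] WithLp 2 (X × X) :=
  LinearMap.toContinuousLinearMap
    { toFun := fun z => WithLp.toLp 2 (z.fst, c • z.fst + h • z.snd)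
      map_add' := fun z z' => by
        change WithLp.toLp 2 (z.fst + z'.fst, c • (z.fst + z'.fst) + h • (z.snd + z'.snd)) =
          WithLp.toLp 2 (z.fst + z'.fst, (c • z.fst + h • z.snd) + (c • z'.fst + h • z'.snd))
        congr 2
        module
      map_smul' := fun r z => by
        change WithLp.toLp 2 (r • z.fst, c • r • z.fst + h • r • z.snd) =
          WithLp.toLp 2 (r • z.fst, r • (c • z.fst + h • z.snd))
        congr 2
        module }

/-- The linear map `(a, b) ↦ (a + c b, h b)`, adjoint to `shear X c h`. -/
noncomputable def shearAdjoint (X : Type*) [NormedAddCommGroup X] [InnerProductSpace ℝ X]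
    [FiniteDimensional ℝ X] (c h : ℝ) : WithLp 2 (X × X) →L[ℝ] WithLp 2 (X × X) :=
  LinearMap.toContinuousLinearMap
    { toFun := fun z => WithLp.toLp 2 (z.fst + c • z.snd, h • z.snd)
      map_add' := fun z z' => by
        change WithLp.toLp 2 (z.fst + z'.fst + c • (z.snd + z'.snd), h • (z.snd + z'.snd)) =
          WithLp.toLp 2 ((z.fst + c • z.snd) + (z'.fst + c • z'.snd), h • z.snd + h • z'.snd)
        congr 2 <;> module
      map_smul' := fun r z => by
        change WithLp.toLp 2 (r • z.fst + c • r • z.snd, h • r • z.snd) =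
          WithLp.toLp 2 (r • (z.fst + c • z.snd), r • h • z.snd)
        congr 2 <;> module }

theorem shear_apply (c h : ℝ) (z : WithLp 2 (X × X)) :
    shear X c h z = WithLp.toLp 2 (z.fst, c • z.fst + h • z.snd) := rfl

theorem shearAdjoint_apply (c h : ℝ) (z : WithLp 2 (X × X)) :
    shearAdjoint X c h z = WithLp.toLp 2 (z.fst + c • z.snd, h • z.snd) := rfl

theorem inner_shearAdjoint (c h : ℝ) (y z : WithLp 2 (X × X)) :
    inner ℝ (shearAdjoint X c h y) z = inner ℝ y (shear X c h z) := by
  rw [shear_apply, shearAdjoint_apply, WithLp.prod_inner_apply, WithLp.prod_inner_apply]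
  change inner ℝ (y.fst + c • y.snd) z.fst + inner ℝ (h • y.snd) z.snd =
    inner ℝ y.fst z.fst + inner ℝ y.snd (c • z.fst + h • z.snd)
  simp only [inner_add_left, inner_add_right, real_inner_smul_left, real_inner_smul_right]
  ring

theorem shear_shear {c h c' h' : ℝ} (hc : c + h * c' = 0) (hh : h * h' = 1)
    (z : WithLp 2 (X × X)) : shear X c h (shear X c' h' z) = z := by
  rw [shear_apply, shear_apply]
  change WithLp.toLp 2 (z.fst, c • z.fst + h • (c' • z.fst + h' • z.snd)) = z
  have : c • z.fst + h • (c' • z.fst + h' • z.snd) = (c + h * c') • z.fst + (h * h') • z.snd := by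
    module
  rw [this, hc, hh, zero_smul, zero_add, one_smul]
  rfl

/-- The shear (x, w) ↦ (x, x + h w) maps the graph of `S` onto that of `eulerMap h S`. Its adjoint
sends (v, -p) to (v - p, -h p), and rescaling by h⁻¹, allowed in a cone, gives the right-hand side.
The converse uses the inverse shear, with parameters -h⁻¹ and h⁻¹. -/
theorem mem_coderivative_eulerMap {h : ℝ} (hh : 0 < h) {S : SetMap X X} {x y v p : X} :
    v ∈ coderivative (eulerMap h S) x y p ↔
      h⁻¹ • (v - p) ∈ coderivative S x (h⁻¹ • (y - x)) p := by
  have hA : Set.MapsTo (shear X 1 h) (svGraph S) (svGraph (eulerMap h S)) := fun z hz => by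
    rw [shear_apply, mem_svGraph, one_smul]
    exact ⟨z.snd, hz, rfl⟩
  have hA' : Set.MapsTo (shear X (-h⁻¹) h⁻¹) (svGraph (eulerMap h S)) (svGraph S) := fun z hz => by
    rw [shear_apply, mem_svGraph]
    have := (mem_eulerMap hh).1 hz
    convert this using 1
    module
  have hr : Function.RightInverse (shear X (-h⁻¹) h⁻¹) (shear X 1 h) :=
    shear_shear (by field_simp; ring) (by field_simp)
  have hl : Function.LeftInverse (shear X (-h⁻¹) h⁻¹) (shear X 1 h) :=
    shear_shear (by field_simp; ring) (by field_simp)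
  have e₁ : shear X 1 h (WithLp.toLp 2 (x, h⁻¹ • (y - x))) = WithLp.toLp 2 (x, y) := by
    rw [shear_apply]
    change WithLp.toLp 2 (x, (1 : ℝ) • x + h • h⁻¹ • (y - x)) = _
    rw [smul_inv_smul₀ hh.ne', one_smul, add_sub_cancel]
  have e₂ : shear X (-h⁻¹) h⁻¹ (WithLp.toLp 2 (x, y)) = WithLp.toLp 2 (x, h⁻¹ • (y - x)) := by
    rw [← e₁, hl]
  constructor
  · intro hv
    have hv : WithLp.toLp 2 (v, -p) ∈ limitingNormalCone _ _ := hv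
    rw [← e₁] at hv
    have := smul_mem_limitingNormalCone (limitingNormalCone_pullback _ _ (shearAdjoint X 1 h)
      (inner_shearAdjoint 1 h) hA hA' hr hl hv) (inv_pos.2 hh)
    have e : h⁻¹ • shearAdjoint X 1 h (WithLp.toLp 2 (v, -p)) =
        WithLp.toLp 2 (h⁻¹ • (v - p), -p) := by
      rw [shearAdjoint_apply]
      change WithLp.toLp 2 (h⁻¹ • (v + (1 : ℝ) • -p), h⁻¹ • h • -p) = _
      rw [inv_smul_smul₀ hh.ne', one_smul, sub_eq_add_neg]
    rwa [e] at this
  · intro hv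
    have hv : WithLp.toLp 2 (h⁻¹ • (v - p), -p) ∈ limitingNormalCone _ _ := hv
    rw [← e₂] at hv
    have := smul_mem_limitingNormalCone (limitingNormalCone_pullback _ _
      (shearAdjoint X (-h⁻¹) h⁻¹) (inner_shearAdjoint _ _) hA' hA hl hr hv) hh
    have e : h • shearAdjoint X (-h⁻¹) h⁻¹ (WithLp.toLp 2 (h⁻¹ • (v - p), -p)) =
        WithLp.toLp 2 (v, -p) := by
      rw [shearAdjoint_apply]
      change WithLp.toLp 2 (h • (h⁻¹ • (v - p) + (-h⁻¹) • -p), h • h⁻¹ • -p) = _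
      have : h⁻¹ • (v - p) + (-h⁻¹) • -p = h⁻¹ • v := by module
      rw [this, smul_inv_smul₀ hh.ne', smul_inv_smul₀ hh.ne']
    rwa [e] at this

end Euler

/-! ### Translation to the discretized inclusion and the main theorem. -/

theorem mem_pathCoderivative {n : ℕ} {F : ℝ → SetMap (Eucl n) (Eucl n)} {T : ℝ} {N : ℕ}
    {x : Fin (N + 1) → Eucl n} {v p : Eucl n} :
    v ∈ pathCoderivative F T N x p ↔ ∃ q : Fin (N + 1) → Eucl n, q 0 = v ∧ q (Fin.last N) = p ∧
      ∀ k : Fin N, q k.castSucc ∈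
        coderivative (discM F T N k) (x k.castSucc) (x k.succ) (q k.succ) :=
  mem_svCompChain

theorem hasDiscreteAdjoint_iff {n : ℕ} {F : ℝ → SetMap (Eucl n) (Eucl n)} {T : ℝ} {N : ℕ}
    (hh : 0 < T / (N : ℝ)) {x0 xN p0 pN : Eucl n} :
    HasDiscreteAdjoint F T N x0 xN p0 pN ↔
      ∃ x ∈ feasiblePaths F T N x0 xN, p0 ∈ pathCoderivative F T N x pN := by
  simp only [mem_pathCoderivative]
  refine exists_congr fun x => and_congr_right fun _ => exists_congr fun p =>
    and_congr_right fun _ => and_congr_right fun _ => forall_congr' fun k => ?_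
  -- The outer minus sign reverses the difference quotient, leaving exactly the coderivative
  -- condition for one Euler step.
  rw [Set.mem_neg, ← smul_neg, neg_sub, one_div]
  exact (mem_coderivative_eulerMap hh).symm

theorem mainTheorem2 (n : ℕ) (T : ℝ) (hT : 0 < T) (N : ℕ) (hN : 1 ≤ N)
    (F : ℝ → SetMap (Eucl n) (Eucl n))
    (hLip : ∀ k : Fin N, SVLocallyLipschitz (discF F T N k))
    (hBdd : ∀ k : Fin N, SVLocallyBounded (discF F T N k)) :
    discReach F T N = svCompChain N (fun k : Fin N => discM F T N (k.rev : ℕ)) ∧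
    ∀ x0 xN : Eucl n, xN ∈ discReach F T N x0 →
      (∀ p : Eucl n, coderivative (discReach F T N) x0 xN p ⊆
        ⋃ x ∈ feasiblePaths F T N x0 xN, pathCoderivative F T N x p) ∧
      ((∀ k : Fin N, GraphConvex (discF F T N k)) →
        ∀ x ∈ feasiblePaths F T N x0 xN,
          coderivative (discReach F T N) x0 xN = pathCoderivative F T N x) ∧
      (∀ p0 pN : Eucl n, p0 ∈ coderivative (discReach F T N) x0 xN pN →
        HasDiscreteAdjoint F T N x0 xN p0 pN) ∧
      ((∀ k : Fin N, GraphConvex (discF F T N k)) →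
        ∀ p0 pN : Eucl n, HasDiscreteAdjoint F T N x0 xN p0 pN →
          p0 ∈ coderivative (discReach F T N) x0 xN pN) := by
  have hh : 0 < T / (N : ℝ) := by
    have : (0 : ℝ) < N := by exact_mod_cast hN
    positivity
  -- `discM` is definitionally `eulerMap` with step T / N applied to `discF`.
  have hL : ∀ k : Fin N, SVLocallyLipschitz (discM F T N k) := fun k => (hLip k).eulerMap hh
  have hB : ∀ k : Fin N, SVLocallyBounded (discM F T N k) := fun k => (hBdd k).eulerMap hh
  have hR : discReach F T N = chainReach N fun k : Fin N => discM F T N k := rfl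
  have upper : ∀ x0 xN p v : Eucl n, v ∈ coderivative (discReach F T N) x0 xN p →
      ∃ x ∈ feasiblePaths F T N x0 xN, v ∈ pathCoderivative F T N x p := by
    intro x0 xN p v hv
    rw [hR] at hv
    obtain ⟨x, hx, hx0, hxN, hq⟩ := exists_path_adjoint hL hB hv
    exact ⟨x, ⟨hx, hx0, hxN⟩, mem_pathCoderivative.2 hq⟩
  have lower : (∀ k : Fin N, GraphConvex (discF F T N k)) → ∀ x0 xN p v : Eucl n,
      ∀ x ∈ feasiblePaths F T N x0 xN, v ∈ pathCoderivative F T N x p →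
        v ∈ coderivative (discReach F T N) x0 xN p := by
    rintro hc _ _ p v x ⟨hx, rfl, rfl⟩ hv
    obtain ⟨q, rfl, rfl, hq⟩ := mem_pathCoderivative.1 hv
    exact mem_coderivative_chainReach_of_graphConvex (fun k => (hc k).eulerMap hh) hx hq
  refine ⟨hR.trans (chainReach_eq_svCompChain N _), fun x0 xN _ => ⟨fun p v hv => ?_,
    fun hc x hx => ?_, fun p0 pN hp => ?_, fun hc p0 pN hp => ?_⟩⟩
  · simpa using upper x0 xN p v hv
  · ext p v
    refine ⟨fun hv => ?_, lower hc x0 xN p v x hx⟩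
    obtain ⟨hx, rfl, rfl⟩ := hx
    exact mem_pathCoderivative.2
      (exists_adjoint_of_graphConvex hL hB (fun k => (hc k).eulerMap hh) hx hv)
  · exact (hasDiscreteAdjoint_iff hh).2 (upper x0 xN pN p0 hp)
  · obtain ⟨x, hx, hxp⟩ := (hasDiscreteAdjoint_iff hh).1 hp
    exact lower hc x0 xN pN p0 x hx hxp
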